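/- There is an absolute constant $c>0$ such that the following holds. Let $H\in(0,1)$, $\beta\in\mathbb{R}$ with $|\beta|<1$, and $\sigma\in\mathbb{R}$. Let $(B^H_t)_{t\in[0,1]}$ be a fractional Brownian motion with Hurst parameter $H$, i.e. a centered Gaussian process with continuous paths and covariance $\mathbb{E}[B^H_tB^H_s]=\tfrac12\left(|t|^{2H}+|s|^{2H}-|t-s|^{2H}\right)$, and let $(X_t)_{t\in[0,1]}$ be the fractional Ornstein--Uhlenbeck process $$dX_t=-\beta X_t\,dt+\sigma\,dB^H_t,\qquad X_0=0,$$ i.e. almost surely $X_t=-\beta\int_0^tX_s\,ds+\sigma B^H_t$ for all $t\in[0,1]$. Then $\sup_{t\in[0,1]}X_t$ is integrable and $$\mathbb{E}\left[\sup_{t\in[0,1]}X_t\right]\;\ge\; c\,e^{-1/2}\sqrt{\frac1H\,\log\!\left(\frac{\sigma\,C_\beta}{e^{-1/2}}\right)},\qquad C_\beta=e^{-2|\beta|}.$$ The right-hand side is a real number exactly when $\sigma\ge e^{2|\beta|-1/2}$. For $\sigma<0$ it is to be read with $|\sigma|$ in place of $\sigma$, and for $|\sigma|<e^{2|\beta|-1/2}$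 it is to be read as $0$. -/

import Mathlib

open MeasureTheory ProbabilityTheory

/-- Fractional Brownian motion on `[0, T]` with Hurst parameter `H`: a centered Gaussian process
with the covariance `(|t|^{2H} + |s|^{2H} - |t - s|^{2H}) / 2` and with (almost surely) continuous
paths. Values of `B` at times outside `[0, T]` are irrelevant. -/
structure IsFractionalBrownianMotion {Ω : Type*} [MeasurableSpace Ω]
    (H T : ℝ) (B : ℝ → Ω → ℝ) (P : Measure Ω) : Prop where
  isGaussianProcess : IsGaussianProcess (fun t : Set.Icc (0 : ℝ) T => B t) P
  centered : ∀ t ∈ Set.Icc (0 : ℝ) T, ∫ ω, B t ω ∂P = 0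
  covariance : ∀ t ∈ Set.Icc (0 : ℝ) T, ∀ s ∈ Set.Icc (0 : ℝ) T,
    ∫ ω, B t ω * B s ω ∂P
      = (1 / 2) * (|t| ^ (2 * H) + |s| ^ (2 * H) - |t - s| ^ (2 * H))
  continuous_paths : ∀ᵐ ω ∂P, ContinuousOn (fun t => B t ω) (Set.Icc 0 T)

/-- `X` solves `dX_t = -β X_t dt + σ dB_t` on `[0, T]` with `X_0 = 0`, in the usual integrated
(pathwise) sense: almost surely, `X_t = X_0 - β ∫_0^t X_s ds + σ (B_t - B_0)` for all
`t ∈ [0, T]`. -/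
structure IsFractionalOUProcess {Ω : Type*} [MeasurableSpace Ω]
    (β σ T : ℝ) (B X : ℝ → Ω → ℝ) (P : Measure Ω) : Prop where
  initial : ∀ᵐ ω ∂P, X 0 ω = 0
  integrable_paths : ∀ᵐ ω ∂P, IntervalIntegrable (fun s => X s ω) volume 0 T
  equation : ∀ᵐ ω ∂P, ∀ t ∈ Set.Icc (0 : ℝ) T,
    X t ω = X 0 ω + (-β) * (∫ s in (0 : ℝ)..t, X s ω) + σ * (B t ω - B 0 ω)

open scoped NNReal ENNReal

/-! The argument proves the stronger linear bound `E[sup X] ≥ (e⁻²/64) |σ| / √H` and then uses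
`√(log y) ≤ |y|`; the factor `e^{-2|β|} ≤ 1` is simply dropped.

The core is that any integrable bound of `|B|` has mean at least of order `1/√H`
(`inv_sqrt_le_integral`). For `H ≤ 1/2` the increments of `B` over a uniform grid are pairwise
nonpositively correlated. With about `e^{1/H}` cells each increment has standard deviation of order
one, and a second moment argument makes some increment exceed a level of order `1/√H` with
probability at least `1/2`. For `H > 1/2` the single variable `B 1` suffices.

To pass to `X`, the equation gives `σ B = X + β ∫ X`, hence `|σ| |B| ≤ 2 sup |X|`, and `sup |X| ≤
sup X + sup (-X)`. The last two have equal means: `sup X` is a measurable functional of `B` on the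
rationals, and `B` and `-B` have the same law there.

Integrability of `sup X` follows from variation of constants and an integrable bound of `|B|`
obtained by dyadic chaining. -/

/-! ### Gaussian tails. -/

lemma gaussianReal_zero_eq_map_sqrt_mul (v : ℝ≥0) :
    gaussianReal 0 v = (gaussianReal 0 1).map (√(v : ℝ) * ·) := by
  rw [gaussianReal_map_const_mul]
  congr 1
  · simp
  · ext; simp

lemma gaussianReal_Ioi_sqrt_mul {v : ℝ≥0} (hv : v ≠ 0) (y : ℝ) :
    (gaussianReal 0 v).real (Set.Ioi (√(v : ℝ) * y)) = (gaussianReal 0 1).real (Set.Ioi y) := by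
  have hpos : 0 < √(v : ℝ) := Real.sqrt_pos.2 (by positivity)
  rw [gaussianReal_zero_eq_map_sqrt_mul v, map_measureReal_apply (by fun_prop) measurableSet_Ioi]
  congr 1
  ext x
  simp only [Set.mem_preimage, Set.mem_Ioi]
  exact mul_lt_mul_iff_right₀ hpos

/-- Both laws are scalings of one standard Gaussian `g`; since `x ≥ 0` only positive `g` matter, and
there the larger scaling gives the larger value. -/
lemma gaussianReal_Ioi_mono {w v : ℝ≥0} (h : w ≤ v) {x : ℝ} (hx : 0 ≤ x) :
    (gaussianReal 0 w).real (Set.Ioi x) ≤ (gaussianReal 0 v).real (Set.Ioi x) := by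
  rw [gaussianReal_zero_eq_map_sqrt_mul w, gaussianReal_zero_eq_map_sqrt_mul v,
    map_measureReal_apply (by fun_prop) measurableSet_Ioi,
    map_measureReal_apply (by fun_prop) measurableSet_Ioi]
  refine measureReal_mono (fun g hg => ?_)
  simp only [Set.mem_preimage, Set.mem_Ioi] at hg ⊢
  have hw : √(w : ℝ) ≤ √(v : ℝ) := Real.sqrt_le_sqrt (by exact_mod_cast h)
  have hg0 : 0 < g := by
    by_contra! hneg
    nlinarith [Real.sqrt_nonneg (w : ℝ)]
  nlinarith

/-- The density decreases on the unit interval `(y, y + 1]`, so its value at the right end bounds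
the integral from below. -/
lemma gaussianReal_Ioi_ge {y : ℝ} (hy : 0 ≤ y) :
    (√(2 * Real.pi))⁻¹ * Real.exp (-(y + 1) ^ 2 / 2) ≤ (gaussianReal 0 1).real (Set.Ioi y) := by
  have h1 : (gaussianReal 0 1).real (Set.Ioi y) = ∫ x in Set.Ioi y, gaussianPDFReal 0 1 x := by
    rw [measureReal_def, gaussianReal_apply_eq_integral _ (by simp), ENNReal.toReal_ofReal]
    exact setIntegral_nonneg measurableSet_Ioi fun x _ => gaussianPDFReal_nonneg 0 1 x
  rw [h1]
  calc (√(2 * Real.pi))⁻¹ * Real.exp (-(y + 1) ^ 2 / 2)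
      = ∫ _ in Set.Ioc y (y + 1), (√(2 * Real.pi))⁻¹ * Real.exp (-(y + 1) ^ 2 / 2) := by
        simp
    _ ≤ ∫ x in Set.Ioc y (y + 1), gaussianPDFReal 0 1 x := by
        refine setIntegral_mono_on (integrableOn_const (by simp)) (integrable_gaussianPDFReal 0 1).integrableOn
          measurableSet_Ioc fun x hx => ?_
        simp only [gaussianPDFReal, NNReal.coe_one, mul_one, sub_zero]
        gcongr
        exacts [by linarith [hx.1], hx.2]
    _ ≤ ∫ x in Set.Ioi y, gaussianPDFReal 0 1 x :=
        setIntegral_mono_set (integrable_gaussianPDFReal 0 1).integrableOn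
          (Filter.Eventually.of_forall fun x => gaussianPDFReal_nonneg 0 1 x)
          (Set.Ioc_subset_Ioi_self.eventuallyLE)

/-! ### Nonpositive correlation and the second moment method. -/

section

variable {Ω : Type*} [MeasurableSpace Ω] {P : Measure Ω}

lemma ProbabilityTheory.HasGaussianLaw.measureReal_gt {U : Ω → ℝ} (hU : HasGaussianLaw U P) (h0 : P[U] = 0) (x : ℝ) :
    P.real {ω | x < U ω} = (gaussianReal 0 Var[U; P].toNNReal).real (Set.Ioi x) := by
  rw [← h0, ← hU.map_eq_gaussianReal,
    map_measureReal_apply_of_aemeasurable hU.aemeasurable measurableSet_Ioi]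
  rfl

variable [IsProbabilityMeasure P]

/-- Regression: `R = V + ρ U`, with `ρ ≥ 0` making `R` uncorrelated with `U`, is independent of `U`
by joint Gaussianity. On `U > x ≥ 0` the event `V > x` forces `R > x`, and `Var R ≤ Var V` gives `R`
the lighter tail. -/
lemma measureReal_gt_inter_le_of_covariance_nonpos {U V : Ω → ℝ}
    (hUV : HasGaussianLaw (fun ω => (U ω, V ω)) P) (hU0 : P[U] = 0) (hV0 : P[V] = 0)
    (hvar : 0 < Var[U; P]) (hcov : cov[U, V; P] ≤ 0) {x : ℝ} (hx : 0 ≤ x) :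
    P.real ({ω | x < U ω} ∩ {ω | x < V ω}) ≤ P.real {ω | x < U ω} * P.real {ω | x < V ω} := by
  set ρ : ℝ := -cov[U, V; P] / Var[U; P] with hρ
  have hρ0 : 0 ≤ ρ := div_nonneg (by linarith) hvar.le
  have hU2 := hUV.fst.memLp_two
  have hV2 := hUV.snd.memLp_two
  have hUR : HasGaussianLaw (fun ω => (U ω, (V + ρ • U) ω)) P :=
    hUV.map ((ContinuousLinearMap.fst ℝ ℝ ℝ).prod
      (ContinuousLinearMap.snd ℝ ℝ ℝ + ρ • ContinuousLinearMap.fst ℝ ℝ ℝ))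
  have hcovUR : cov[U, V + ρ • U; P] = 0 := by
    rw [covariance_add_right hU2 hV2 (hU2.const_smul ρ), covariance_smul_right,
      covariance_self hU2.aemeasurable, hρ]
    field_simp
    ring
  have hind := hUR.indepFun_of_covariance_eq_zero hcovUR
  have hR0 : P[V + ρ • U] = 0 := by
    have := integral_add hUV.snd.integrable (hUV.fst.integrable.smul ρ)
    simp only [Pi.smul_apply, integral_smul, hU0, hV0, smul_zero, add_zero] at this
    exact this
  have hvarR : Var[V + ρ • U; P] ≤ Var[V; P] := by
    rw [variance_add hV2 (hU2.const_smul ρ), variance_smul, covariance_smul_right,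
      covariance_comm]
    have : cov[U, V; P] = -ρ * Var[U; P] := by rw [hρ]; field_simp
    rw [this]
    nlinarith [mul_nonneg (mul_nonneg hρ0 hρ0) hvar.le]
  calc P.real ({ω | x < U ω} ∩ {ω | x < V ω})
      ≤ P.real (U ⁻¹' Set.Ioi x ∩ (V + ρ • U) ⁻¹' Set.Ioi x) := by
        refine measureReal_mono fun ω hω => ⟨hω.1, ?_⟩
        have h1 : x < U ω := hω.1
        have h2 : x < V ω := hω.2
        simp only [Set.mem_preimage, Pi.add_apply, Pi.smul_apply, smul_eq_mul, Set.mem_Ioi]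
        nlinarith
    _ = P.real (U ⁻¹' Set.Ioi x) * P.real ((V + ρ • U) ⁻¹' Set.Ioi x) := by
        simp only [measureReal_def]
        rw [hind.measure_inter_preimage_eq_mul _ _ measurableSet_Ioi measurableSet_Ioi,
          ENNReal.toReal_mul]
    _ ≤ P.real {ω | x < U ω} * P.real {ω | x < V ω} := by
        refine mul_le_mul_of_nonneg_left ?_ measureReal_nonneg
        have := HasGaussianLaw.measureReal_gt hUR.snd hR0 x
        rw [HasGaussianLaw.measureReal_gt hUV.snd hV0 x]
        exact this.trans_le (gaussianReal_Ioi_mono (Real.toNNReal_le_toNNReal hvarR) hx)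

/-- Second moment method for the number `S` of events that occur: `E S = m` and `E S² ≤ m + m²`,
which forces `P(S > 0) ≥ m / (1 + m)`, at least `1/2` when `m ≥ 1`. -/
lemma half_le_measureReal_iUnion_of_pairwise {ι : Type*} [Fintype ι] {A : ι → Set Ω}
    (hA : ∀ i, NullMeasurableSet (A i) P) {p : ℝ} (hp : ∀ i, P.real (A i) = p)
    (hpair : ∀ i j, i ≠ j → P.real (A i ∩ A j) ≤ p * p) (hcard : 1 ≤ Fintype.card ι * p) :
    1 / 2 ≤ P.real (⋃ i, A i) := by
  classical
  set m : ℝ := Fintype.card ι * p with hm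
  -- This `a` maximizes `2 a m - a² (m + m²)`, the lower bound obtained by integrating `2 a S - a²
  -- S² ≤ 1_{S > 0}`.
  set a : ℝ := 1 / (1 + m) with ha
  have ha0 : 0 < a := by positivity
  set S : Ω → ℝ := fun ω => ∑ i, (A i).indicator 1 ω with hS
  have hint : ∀ s : Set Ω, NullMeasurableSet s P → Integrable (s.indicator (1 : Ω → ℝ)) P :=
    fun s hs => (integrable_const (1 : ℝ)).indicator₀ hs
  have hI : ∀ s : Set Ω, NullMeasurableSet s P → ∫ ω, s.indicator (1 : Ω → ℝ) ω ∂P = P.real s := by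
    intro s hs
    rw [integral_indicator₀ hs]
    simp
  have hSq : ∀ ω, S ω ^ 2 = ∑ i, ∑ j, (A i ∩ A j).indicator (1 : Ω → ℝ) ω := by
    intro ω
    rw [hS, sq, Finset.sum_mul_sum]
    simp [Set.inter_indicator_one]
  have hSint : Integrable S P := integrable_finsetSum _ fun i _ => hint _ (hA i)
  have hSqint : Integrable (fun ω => S ω ^ 2) P := by
    simp_rw [hSq]
    exact integrable_finsetSum _ fun i _ => integrable_finsetSum _ fun j _ =>
      hint _ ((hA i).inter (hA j))
  have hES : ∫ ω, S ω ∂P = m := by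
    rw [hS, integral_finsetSum _ fun i _ => hint _ (hA i)]
    simp_rw [hI _ (hA _), hp]
    simp [hm]
  have hp0 : 0 ≤ p := by
    by_contra! h
    have : (Fintype.card ι : ℝ) * p ≤ 0 := mul_nonpos_of_nonneg_of_nonpos (by positivity) h.le
    linarith
  have hESq : ∫ ω, S ω ^ 2 ∂P ≤ m + m ^ 2 := by
    simp_rw [hSq]
    rw [integral_finsetSum _ fun i _ => integrable_finsetSum _ fun j _ =>
      hint _ ((hA i).inter (hA j))]
    calc ∑ i, ∫ ω, ∑ j, (A i ∩ A j).indicator (1 : Ω → ℝ) ω ∂P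
        = ∑ i, ∑ j, P.real (A i ∩ A j) := by
          refine Finset.sum_congr rfl fun i _ => ?_
          rw [integral_finsetSum _ fun j _ => hint _ ((hA i).inter (hA j))]
          exact Finset.sum_congr rfl fun j _ => hI _ ((hA i).inter (hA j))
      _ ≤ ∑ i : ι, ∑ j : ι, ((if i = j then p else 0) + p * p) := by
          gcongr with i _ j _
          by_cases h : i = j
          · subst h
            simp only [Set.inter_self, hp, if_true]
            nlinarith
          · simpa [h] using hpair i j h
      _ = m + m ^ 2 := by
          simp [Finset.sum_add_distrib, hm]
          ring
  have hU : NullMeasurableSet (⋃ i, A i) P := NullMeasurableSet.iUnion hA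
  have hle : ∫ ω, (2 * a * S ω - a ^ 2 * S ω ^ 2) ∂P ≤ ∫ ω, (⋃ i, A i).indicator (1 : Ω → ℝ) ω ∂P := by
    refine integral_mono ((hSint.const_mul _).sub (hSqint.const_mul _)) (hint _ hU) fun ω => ?_
    by_cases h : ω ∈ ⋃ i, A i
    · simp only [Set.indicator_of_mem h, Pi.one_apply]
      nlinarith [sq_nonneg (1 - a * S ω)]
    · have : S ω = 0 := by
        refine Finset.sum_eq_zero fun i _ => Set.indicator_of_notMem (fun hi => h ?_) _
        exact Set.mem_iUnion.2 ⟨i, hi⟩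
      simp [this, Set.indicator_of_notMem h]
  rw [hI _ hU, integral_sub (hSint.const_mul _) (hSqint.const_mul _), integral_const_mul,
    integral_const_mul, hES] at hle
  have h2 : 2 * a * m - a ^ 2 * (m + m ^ 2) = m / (1 + m) := by
    rw [ha]; field_simp; ring
  have h3 : 1 / 2 ≤ m / (1 + m) := by
    rw [div_le_div_iff₀ (by norm_num) (by positivity)]; linarith
  nlinarith [mul_le_mul_of_nonneg_left hESq (sq_nonneg a)]

end

/-! ### Laws and covariances of the increments of fractional Brownian motion. -/

namespace IsFractionalBrownianMotion

variable {Ω : Type*} [MeasurableSpace Ω] {P : Measure Ω} {H T : ℝ} {B : ℝ → Ω → ℝ}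

lemma hasGaussianLaw_eval (hB : IsFractionalBrownianMotion H T B P) {t : ℝ}
    (ht : t ∈ Set.Icc 0 T) : HasGaussianLaw (B t) P :=
  hB.isGaussianProcess.hasGaussianLaw_eval ⟨t, ht⟩

lemma hasGaussianLaw_increment (hB : IsFractionalBrownianMotion H T B P) {a b : ℝ}
    (ha : a ∈ Set.Icc 0 T) (hb : b ∈ Set.Icc 0 T) : HasGaussianLaw (fun ω => B b ω - B a ω) P :=
  hB.isGaussianProcess.hasGaussianLaw_fun_sub (s := ⟨b, hb⟩) (t := ⟨a, ha⟩)

lemma hasGaussianLaw_increments (hB : IsFractionalBrownianMotion H T B P) {a b c d : ℝ}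
    (ha : a ∈ Set.Icc 0 T) (hb : b ∈ Set.Icc 0 T) (hc : c ∈ Set.Icc 0 T) (hd : d ∈ Set.Icc 0 T) :
    HasGaussianLaw (fun ω => (B b ω - B a ω, B d ω - B c ω)) P := by
  classical
  have h := (hB.isGaussianProcess.comp_right
    (![⟨a, ha⟩, ⟨b, hb⟩, ⟨c, hc⟩, ⟨d, hd⟩] : Fin 4 → Set.Icc (0 : ℝ) T)).hasGaussianLaw Finset.univ
  let e (i : Fin 4) : (↥(Finset.univ : Finset (Fin 4)) → ℝ) →L[ℝ] ℝ :=
    ContinuousLinearMap.proj ⟨i, Finset.mem_univ i⟩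
  exact h.map ((e 1 - e 0).prod (e 3 - e 2))

lemma integral_increment (hB : IsFractionalBrownianMotion H T B P) {a b : ℝ}
    (ha : a ∈ Set.Icc 0 T) (hb : b ∈ Set.Icc 0 T) : ∫ ω, (B b ω - B a ω) ∂P = 0 := by
  rw [integral_sub (hB.hasGaussianLaw_eval hb).integrable (hB.hasGaussianLaw_eval ha).integrable,
    hB.centered a ha, hB.centered b hb, sub_zero]

lemma ae_eval_zero_eq_zero (hB : IsFractionalBrownianMotion H T B P) (hH : 0 < H) (hT : 0 ≤ T) :
    ∀ᵐ ω ∂P, B 0 ω = 0 := by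
  have h0 : (0 : ℝ) ∈ Set.Icc 0 T := ⟨le_rfl, hT⟩
  have hint := (hB.hasGaussianLaw_eval h0).memLp_two.integrable_mul
    (hB.hasGaussianLaw_eval h0).memLp_two
  have h := hB.covariance 0 h0 0 h0
  rw [sub_self, abs_zero, Real.zero_rpow (by positivity)] at h
  norm_num at h
  have := (integral_eq_zero_iff_of_nonneg (fun ω => mul_self_nonneg (B 0 ω)) hint).1 h
  filter_upwards [this] with ω hω
  simpa using hω

variable [IsProbabilityMeasure P]

lemma covariance_eval (hB : IsFractionalBrownianMotion H T B P) {s t : ℝ}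
    (hs : s ∈ Set.Icc 0 T) (ht : t ∈ Set.Icc 0 T) :
    cov[B s, B t; P] = (1 / 2) * (|s| ^ (2 * H) + |t| ^ (2 * H) - |s - t| ^ (2 * H)) := by
  rw [covariance_eq_sub (hB.hasGaussianLaw_eval hs).memLp_two (hB.hasGaussianLaw_eval ht).memLp_two,
    hB.centered s hs, zero_mul, sub_zero]
  exact hB.covariance s hs t ht

lemma covariance_increments (hB : IsFractionalBrownianMotion H T B P) {a b c d : ℝ}
    (ha : a ∈ Set.Icc 0 T) (hb : b ∈ Set.Icc 0 T) (hc : c ∈ Set.Icc 0 T) (hd : d ∈ Set.Icc 0 T) :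
    cov[fun ω => B b ω - B a ω, fun ω => B d ω - B c ω; P]
      = (1 / 2) * (|b - c| ^ (2 * H) + |a - d| ^ (2 * H) - |b - d| ^ (2 * H)
          - |a - c| ^ (2 * H)) := by
  have hm := fun {t : ℝ} (ht : t ∈ Set.Icc 0 T) => (hB.hasGaussianLaw_eval ht).memLp_two
  rw [covariance_fun_sub_fun_sub (hm hb) (hm ha) (hm hd) (hm hc), hB.covariance_eval hb hd,
    hB.covariance_eval hb hc, hB.covariance_eval ha hd, hB.covariance_eval ha hc]
  ring

lemma variance_increment (hB : IsFractionalBrownianMotion H T B P) (hH : 0 < H) {a b : ℝ}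
    (ha : a ∈ Set.Icc 0 T) (hb : b ∈ Set.Icc 0 T) :
    Var[fun ω => B b ω - B a ω; P] = |b - a| ^ (2 * H) := by
  rw [← covariance_self (hB.hasGaussianLaw_increment ha hb).aemeasurable,
    hB.covariance_increments ha hb ha hb, abs_sub_comm a b, sub_self, sub_self, abs_zero,
    Real.zero_rpow (by positivity)]
  ring

lemma map_increment (hB : IsFractionalBrownianMotion H T B P) (hH : 0 < H) {a b : ℝ}
    (ha : a ∈ Set.Icc 0 T) (hb : b ∈ Set.Icc 0 T) :
    P.map (fun ω => B b ω - B a ω) = gaussianReal 0 (|b - a| ^ (2 * H)).toNNReal := by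
  rw [(hB.hasGaussianLaw_increment ha hb).map_eq_gaussianReal, hB.integral_increment ha hb,
    hB.variance_increment hH ha hb]

end IsFractionalBrownianMotion

/-! ### Nonpositive correlation of grid increments for `H ≤ 1/2`. -/

lemma rpow_add_rpow_le_two_mul {p u δ : ℝ} (hp0 : 0 ≤ p) (hp1 : p ≤ 1) (hδ : 0 ≤ δ) (hu : δ ≤ u) :
    (u - δ) ^ p + (u + δ) ^ p ≤ 2 * u ^ p := by
  have h := (Real.concaveOn_rpow hp0 hp1).2 (Set.mem_Ici.2 (by linarith : 0 ≤ u - δ))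
    (Set.mem_Ici.2 (by linarith : 0 ≤ u + δ)) (by norm_num : (0 : ℝ) ≤ 1 / 2)
    (by norm_num : (0 : ℝ) ≤ 1 / 2) (by norm_num)
  simp only [smul_eq_mul] at h
  rw [show 1 / 2 * (u - δ) + 1 / 2 * (u + δ) = u by ring] at h
  linarith

namespace IsFractionalBrownianMotion

variable {Ω : Type*} [MeasurableSpace Ω] {P : Measure Ω} [IsProbabilityMeasure P]
  {H : ℝ} {B : ℝ → Ω → ℝ}

/-- The covariance is half a second difference, with step `1 / N`, of `u ↦ u ^ (2 * H)`, which is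
concave because `2 * H ≤ 1`. -/
lemma covariance_increments_nonpos (hB : IsFractionalBrownianMotion H 1 B P) (hH : 0 < H)
    (hH2 : H ≤ 1 / 2) {N i j : ℕ} (hi : i < N) (hj : j < N) (hij : i ≠ j) :
    cov[fun ω => B ((i + 1 : ℕ) / N : ℝ) ω - B (i / N : ℝ) ω,
      fun ω => B ((j + 1 : ℕ) / N : ℝ) ω - B (j / N : ℝ) ω; P] ≤ 0 := by
  wlog h : i < j generalizing i j
  · rw [covariance_comm]
    exact this hj hi hij.symm (by omega)
  have hN : (0 : ℝ) < N := by exact_mod_cast (by omega : 0 < N)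
  have hmem : ∀ k : ℕ, k ≤ N → (k / N : ℝ) ∈ Set.Icc (0 : ℝ) 1 := fun k hk =>
    ⟨by positivity, by rw [div_le_one hN]; exact_mod_cast hk⟩
  rw [hB.covariance_increments (hmem _ hi.le) (hmem _ hi) (hmem _ hj.le) (hmem _ hj)]
  have hji : (i : ℝ) + 1 ≤ j := by exact_mod_cast h
  have hδ : (0 : ℝ) ≤ 1 / N := by positivity
  have hu : (1 / N : ℝ) ≤ (j - i) / N := by gcongr; linarith
  have h2 := rpow_add_rpow_le_two_mul (p := 2 * H) (by positivity) (by linarith) hδ hu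
  have e1 : |((i + 1 : ℕ) / N : ℝ) - j / N| = (j - i) / N - 1 / N := by
    rw [abs_sub_comm, ← abs_of_nonneg (sub_nonneg.2 hu)]; congr 1; push_cast; ring
  have e2 : |(i / N : ℝ) - (j + 1 : ℕ) / N| = (j - i) / N + 1 / N := by
    rw [abs_sub_comm, ← abs_of_nonneg (by linarith : (0 : ℝ) ≤ (j - i) / N + 1 / N)]
    congr 1; push_cast; ring
  have e3 : |((i + 1 : ℕ) / N : ℝ) - (j + 1 : ℕ) / N| = (j - i) / N := by
    rw [abs_sub_comm, ← abs_of_nonneg (hδ.trans hu)]; congr 1; push_cast; ring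
  have e4 : |(i / N : ℝ) - j / N| = (j - i) / N := by
    rw [abs_sub_comm, ← abs_of_nonneg (hδ.trans hu)]; congr 1; ring
  rw [e1, e2, e3, e4]
  linarith

end IsFractionalBrownianMotion

/-! ### The lower bound of order `1 / √H` for bounds of `|B|`. -/

lemma mul_measureReal_le_integral_of_ae {Ω : Type*} [MeasurableSpace Ω] {P : Measure Ω}
    [IsProbabilityMeasure P] {Z : Ω → ℝ} (hZ : Integrable Z P) (hZ0 : 0 ≤ᵐ[P] Z) {A : Set Ω} {z : ℝ}
    (hz : 0 ≤ z) (h : ∀ᵐ ω ∂P, ω ∈ A → z ≤ Z ω) : z * P.real A ≤ ∫ ω, Z ω ∂P := by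
  refine le_trans ?_ (mul_meas_ge_le_integral_of_nonneg hZ0 hZ z)
  refine mul_le_mul_of_nonneg_left ?_ hz
  exact ENNReal.toReal_mono (measure_ne_top _ _) (measure_mono_ae h)

lemma sqrt_two_mul_pi_le_exp_one : √(2 * Real.pi) ≤ Real.exp 1 := by
  rw [Real.sqrt_le_left (Real.exp_pos 1).le]
  nlinarith [Real.pi_lt_d2, Real.exp_one_gt_d9]

namespace IsFractionalBrownianMotion

variable {Ω : Type*} [MeasurableSpace Ω] {P : Measure Ω} [IsProbabilityMeasure P]
  {H : ℝ} {B : ℝ → Ω → ℝ}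

lemma measureReal_increment_gt (hB : IsFractionalBrownianMotion H 1 B P) (hH : 0 < H) {a b : ℝ}
    (ha : a ∈ Set.Icc 0 1) (hb : b ∈ Set.Icc 0 1) (hab : a < b) (y : ℝ) :
    P.real {ω | (b - a) ^ H * y < B b ω - B a ω} = (gaussianReal 0 1).real (Set.Ioi y) := by
  have hba : 0 < b - a := sub_pos.2 hab
  have hpos : 0 < (b - a) ^ (2 * H) := Real.rpow_pos_of_pos hba _
  have hv : (|b - a| ^ (2 * H)).toNNReal ≠ 0 := by
    rw [abs_of_pos hba]
    simpa using hpos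
  have hsqrt : √(((|b - a| ^ (2 * H)).toNNReal : ℝ≥0) : ℝ) = (b - a) ^ H := by
    rw [abs_of_pos hba, Real.coe_toNNReal _ hpos.le, Real.sqrt_eq_rpow, ← Real.rpow_mul hba.le]
    congr 1
    ring
  rw [← gaussianReal_Ioi_sqrt_mul hv, hsqrt, ← hB.map_increment hH ha hb,
    map_measureReal_apply_of_aemeasurable (hB.hasGaussianLaw_increment ha hb).aemeasurable
      measurableSet_Ioi]
  rfl

/-- With probability at least `1/2` some grid increment exceeds `x = (1 / N) ^ H * y`, and then
`|B|` is at least `x / 2` at one end of that cell; the two halves give the factor `1/4`. -/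
lemma mul_le_integral_of_grid (hB : IsFractionalBrownianMotion H 1 B P) (hH : 0 < H)
    (hH2 : H ≤ 1 / 2) {Z : Ω → ℝ} (hZ : Integrable Z P)
    (hBZ : ∀ᵐ ω ∂P, ∀ t ∈ Set.Icc (0 : ℝ) 1, |B t ω| ≤ Z ω) {N : ℕ} {y : ℝ} (hy : 0 ≤ y)
    (hN : 1 ≤ N * (gaussianReal 0 1).real (Set.Ioi y)) :
    (1 / N : ℝ) ^ H * y / 4 ≤ ∫ ω, Z ω ∂P := by
  have hN0 : (0 : ℝ) < N := by
    by_contra! h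
    nlinarith [measureReal_nonneg (μ := gaussianReal 0 1) (s := Set.Ioi y)]
  have hmem : ∀ k : ℕ, k ≤ N → (k / N : ℝ) ∈ Set.Icc (0 : ℝ) 1 := fun k hk =>
    ⟨by positivity, by rw [div_le_one hN0]; exact_mod_cast hk⟩
  have hlen : ∀ k : ℕ, ((k + 1 : ℕ) / N : ℝ) - k / N = 1 / N := fun k => by push_cast; ring
  have hlt : ∀ k : ℕ, (k / N : ℝ) < (k + 1 : ℕ) / N := fun k => by
    rw [← sub_pos, hlen]; positivity
  set x : ℝ := (1 / N : ℝ) ^ H * y with hx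
  have hx0 : 0 ≤ x := by positivity
  let A : Fin N → Set Ω := fun i => {ω | x < B ((i + 1 : ℕ) / N : ℝ) ω - B (i / N : ℝ) ω}
  have hA : ∀ i, P.real (A i) = (gaussianReal 0 1).real (Set.Ioi y) := fun i => by
    have := hB.measureReal_increment_gt hH (hmem i i.2.le) (hmem _ i.2) (hlt i) y
    rwa [hlen] at this
  have hlaw := fun i : Fin N => hB.hasGaussianLaw_increment (hmem i i.2.le) (hmem _ i.2)
  have hmean := fun i : Fin N => hB.integral_increment (hmem i i.2.le) (hmem _ i.2)
  have hhalf : 1 / 2 ≤ P.real (⋃ i, A i) := by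
    refine half_le_measureReal_iUnion_of_pairwise
      (fun i => (hlaw i).aemeasurable.nullMeasurable measurableSet_Ioi) hA (fun i j hij => ?_)
      (by simpa using hN)
    nth_rewrite 1 [← hA i]
    rw [← hA j]
    refine measureReal_gt_inter_le_of_covariance_nonpos
      (hB.hasGaussianLaw_increments (hmem i i.2.le) (hmem _ i.2) (hmem j j.2.le) (hmem _ j.2))
      (hmean i) (hmean j) ?_
      (hB.covariance_increments_nonpos hH hH2 i.2 j.2 (by simpa [Fin.ext_iff] using hij)) hx0
    rw [hB.variance_increment hH (hmem i i.2.le) (hmem _ i.2), hlen]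
    positivity
  have hZ0 : 0 ≤ᵐ[P] Z := by
    filter_upwards [hBZ] with ω hω
    exact (abs_nonneg _).trans (hω 0 (by simp))
  have := mul_measureReal_le_integral_of_ae (A := ⋃ i, A i) (z := x / 2) hZ hZ0 (by positivity) (by
    filter_upwards [hBZ] with ω hω hA
    obtain ⟨i, hi⟩ := Set.mem_iUnion.1 hA
    have h1 := hω _ (hmem i i.2.le)
    have h2 := hω _ (hmem _ i.2)
    have hi' : x < B ((i + 1 : ℕ) / N : ℝ) ω - B (i / N : ℝ) ω := hi
    linarith [neg_abs_le (B (i / N : ℝ) ω), le_abs_self (B ((i + 1 : ℕ) / N : ℝ) ω)])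
  nlinarith

/-- Any integrable bound of `|B|` on `[0, 1]` has an integral of order at least `1 / √H`. -/
lemma inv_sqrt_le_integral (hB : IsFractionalBrownianMotion H 1 B P) (hH : 0 < H)
    {Z : Ω → ℝ} (hZ : Integrable Z P)
    (hBZ : ∀ᵐ ω ∂P, ∀ t ∈ Set.Icc (0 : ℝ) 1, |B t ω| ≤ Z ω) :
    Real.exp (-2) / 16 * (1 / √H) ≤ ∫ ω, Z ω ∂P := by
  have hs : 0 < √H := Real.sqrt_pos.2 hH
  have hss : √H * √H = H := Real.mul_self_sqrt hH.le
  have hpi := sqrt_two_mul_pi_le_exp_one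
  have hpi0 : 0 < √(2 * Real.pi) := by positivity
  rcases le_or_gt H (1 / 2) with hH2 | hH2
  · have hs2 : √H ≤ 3 / 4 := by nlinarith
    -- The shift by `1` makes the exponent in `gaussianReal_Ioi_ge` exactly `-1 / (2H)`.
    set y : ℝ := 1 / √H - 1 with hy
    have hinv : 4 / 3 ≤ 1 / √H := by
      rw [div_le_div_iff₀ (by norm_num) hs]; linarith
    have hy0 : 0 ≤ y := by linarith
    -- Large enough that `N` times the tail is at least `e^{1/(2H)} / √(2π) ≥ 1`, yet `N ≤ e^{2/H}`,
    -- so the scale `N^{-H}` stays above `e⁻²`.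
    set N : ℕ := ⌈Real.exp (1 / H)⌉₊ with hNdef
    have hN1 : Real.exp (1 / H) ≤ N := Nat.le_ceil _
    have hE0 := Real.exp_pos (1 / H)
    have hN0 : (0 : ℝ) < N := hE0.trans_le hN1
    have hinvH : 2 ≤ 1 / H := by rw [le_div_iff₀ hH]; linarith
    have hN2 : (N : ℝ) ≤ Real.exp (2 / H) := by
      have h1 : (N : ℝ) < Real.exp (1 / H) + 1 := Nat.ceil_lt_add_one hE0.le
      have h2 : Real.exp (2 / H) = Real.exp (1 / H) * Real.exp (1 / H) := by
        rw [← Real.exp_add]; congr 1; ring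
      have h3 := Real.add_one_le_exp (1 / H)
      nlinarith
    have hscale : Real.exp (-2) ≤ (1 / N : ℝ) ^ H := by
      have h1 : Real.exp (-2) = (1 / Real.exp (2 / H)) ^ H := by
        rw [one_div, ← Real.exp_neg, ← Real.exp_mul]
        congr 1
        field_simp
      rw [h1]
      gcongr
    have hcount : 1 ≤ N * (gaussianReal 0 1).real (Set.Ioi y) := by
      have htail := gaussianReal_Ioi_ge hy0
      have h1 : -(y + 1) ^ 2 / 2 = -(1 / H) / 2 := by
        rw [hy, sub_add_cancel, div_pow, sq, sq, hss]; ring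
      rw [h1] at htail
      calc (1 : ℝ) ≤ (√(2 * Real.pi))⁻¹ * Real.exp 1 := by
            rw [inv_mul_eq_div, le_div_iff₀ hpi0]; linarith
        _ ≤ (√(2 * Real.pi))⁻¹ * Real.exp (1 / H / 2) := by gcongr; linarith
        _ = Real.exp (1 / H) * ((√(2 * Real.pi))⁻¹ * Real.exp (-(1 / H) / 2)) := by
            rw [mul_left_comm, ← Real.exp_add]; congr 2; ring
        _ ≤ N * (gaussianReal 0 1).real (Set.Ioi y) := by gcongr
    refine le_trans ?_ (hB.mul_le_integral_of_grid hH hH2 hZ hBZ hy0 hcount)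
    have : Real.exp (-2) * (1 / √H / 4) ≤ (1 / N : ℝ) ^ H * y := by
      gcongr
      linarith
    linarith
  -- For `H > 1/2`, `1 / √H` is bounded by `2`, so the event `B 1 > 1` alone gives the bound.
  · have hZ0 : 0 ≤ᵐ[P] Z := by
      filter_upwards [hBZ] with ω hω
      exact (abs_nonneg _).trans (hω 0 (by simp))
    have hmark := mul_measureReal_le_integral_of_ae
      (A := {ω | ((1 : ℝ) - 0) ^ H * 1 < B 1 ω - B 0 ω}) (z := 1) hZ hZ0 (by positivity) (by
      filter_upwards [hBZ, hB.ae_eval_zero_eq_zero hH zero_le_one] with ω hω h0 hA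
      have h1 := hω 1 (by simp)
      have hA' : ((1 : ℝ) - 0) ^ H * 1 < B 1 ω - B 0 ω := hA
      rw [h0, sub_zero, sub_zero, Real.one_rpow] at hA'
      linarith [le_abs_self (B 1 ω)])
    rw [hB.measureReal_increment_gt hH (by simp) (by simp) one_pos 1, one_mul] at hmark
    refine le_trans ?_ ((gaussianReal_Ioi_ge zero_le_one).trans hmark)
    have h1 : 1 / √H ≤ 2 := by
      rw [div_le_iff₀ hs]; nlinarith
    have h2 : 1 / 8 ≤ (√(2 * Real.pi))⁻¹ := by
      rw [← one_div, div_le_div_iff₀ (by norm_num) hpi0]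
      linarith [Real.exp_one_lt_d9]
    have h3 : (-(1 + 1) ^ 2 / 2 : ℝ) = -2 := by norm_num
    rw [h3]
    nlinarith [Real.exp_pos (-2)]

end IsFractionalBrownianMotion

/-! ### Dyadic chaining: an integrable bound of `|B|`. -/

lemma exists_integrable_forall_sum_le {Ω : Type*} [MeasurableSpace Ω] {P : Measure Ω}
    {e : ℕ → Ω → ℝ} (h0 : ∀ n ω, 0 ≤ e n ω) (hint : ∀ n, Integrable (e n) P)
    (hsum : Summable fun n => ∫ ω, e n ω ∂P) :
    ∃ S : Ω → ℝ, Integrable S P ∧ ∀ᵐ ω ∂P, ∀ n, ∑ m ∈ Finset.range n, e m ω ≤ S ω := by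
  have hmeas : ∀ n, AEMeasurable (fun ω => ENNReal.ofReal (e n ω)) P := fun n =>
    (hint n).aemeasurable.ennreal_ofReal
  have hfin : ∫⁻ ω, ∑' n, ENNReal.ofReal (e n ω) ∂P ≠ ∞ := by
    rw [lintegral_tsum hmeas]
    simp_rw [← ofReal_integral_eq_lintegral_ofReal (hint _) (Filter.Eventually.of_forall (h0 _))]
    rw [← ENNReal.ofReal_tsum_of_nonneg (fun n => integral_nonneg (h0 n)) hsum]
    exact ENNReal.ofReal_ne_top
  have hS : AEMeasurable (fun ω => ∑' n, ENNReal.ofReal (e n ω)) P := AEMeasurable.tsum hmeas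
  refine ⟨fun ω => (∑' n, ENNReal.ofReal (e n ω)).toReal,
    integrable_toReal_of_lintegral_ne_top hS hfin, ?_⟩
  filter_upwards [ae_lt_top' hS hfin] with ω hω n
  calc ∑ m ∈ Finset.range n, e m ω
      = (∑ m ∈ Finset.range n, ENNReal.ofReal (e m ω)).toReal := by
        rw [← ENNReal.ofReal_sum_of_nonneg fun m _ => h0 m ω,
          ENNReal.toReal_ofReal (Finset.sum_nonneg fun m _ => h0 m ω)]
    _ ≤ _ := ENNReal.toReal_mono hω.ne (ENNReal.sum_le_tsum _)

/-- A point of level `n + 1` either lies on level `n` (even index) or is one increment to the right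
of such a point (odd index), so each level costs at most one `e n`. -/
lemma abs_dyadic_le_sum {f : ℝ → ℝ} {e : ℕ → ℝ}
    (h : ∀ n k : ℕ, k < 2 ^ n → |f ((k + 1 : ℕ) / 2 ^ n) - f (k / 2 ^ n)| ≤ e n) (n k : ℕ)
    (hk : k ≤ 2 ^ n) : |f (k / 2 ^ n)| ≤ |f 0| + ∑ m ∈ Finset.range (n + 1), e m := by
  have he : ∀ n, 0 ≤ e n := fun n => (abs_nonneg _).trans (h n 0 (by positivity))
  induction n generalizing k with
  | zero =>
    have h0 := h 0 0 (by norm_num)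
    simp only [pow_zero, div_one, zero_add, Nat.cast_one, Nat.cast_zero] at h0
    have hk' : k = 0 ∨ k = 1 := by simp at hk; omega
    rcases hk' with rfl | rfl
    · simpa using he 0
    · simp only [pow_zero, div_one, zero_add, Nat.cast_one, Finset.sum_range_one]
      have := abs_sub_abs_le_abs_sub (f 1) (f 0)
      linarith
  | succ n ih =>
    have hcoarse : ∀ j : ℕ, ((2 * j : ℕ) / 2 ^ (n + 1) : ℝ) = j / 2 ^ n := fun j => by
      push_cast; rw [pow_succ']; field_simp
    rw [Finset.sum_range_succ]
    rw [pow_succ] at hk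
    rcases Nat.even_or_odd' k with ⟨j, rfl | rfl⟩
    · rw [hcoarse]
      linarith [ih j (by omega), he (n + 1)]
    · have h1 := h (n + 1) (2 * j) (by rw [pow_succ]; omega)
      rw [hcoarse] at h1
      have := abs_sub_abs_le_abs_sub (f ((2 * j + 1 : ℕ) / 2 ^ (n + 1))) (f (j / 2 ^ n))
      linarith [ih j (by omega)]

lemma tendsto_floor_mul_div_of_tendsto {u : ℕ → ℕ} (hu : Filter.Tendsto u .atTop .atTop) {t : ℝ}
    (ht : 0 ≤ t) : Filter.Tendsto (fun n => (⌊t * u n⌋₊ : ℝ) / u n) .atTop (nhds t) :=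
  (tendsto_nat_floor_mul_div_atTop ht).comp (tendsto_natCast_atTop_atTop.comp hu)

lemma abs_le_of_continuousOn_of_dyadic {f : ℝ → ℝ} (hf : ContinuousOn f (Set.Icc 0 1)) {M : ℝ}
    (h : ∀ n k : ℕ, k ≤ 2 ^ n → |f (k / 2 ^ n)| ≤ M) {t : ℝ} (ht : t ∈ Set.Icc (0 : ℝ) 1) :
    |f t| ≤ M := by
  have hlim := tendsto_floor_mul_div_of_tendsto
    (u := fun n => 2 ^ n) (tendsto_pow_atTop_atTop_of_one_lt one_lt_two) ht.1
  have hle : ∀ n : ℕ, ⌊t * (2 ^ n : ℕ)⌋₊ ≤ 2 ^ n := fun n =>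
    Nat.floor_le_of_le (mul_le_of_le_one_left (by positivity) ht.2)
  have hmem : ∀ n : ℕ, (⌊t * (2 ^ n : ℕ)⌋₊ : ℝ) / (2 ^ n : ℕ) ∈ Set.Icc (0 : ℝ) 1 := fun n =>
    ⟨by positivity, by
      rw [div_le_one (by positivity)]
      exact_mod_cast hle n⟩
  have := ((hf t ht).tendsto.comp (tendsto_nhdsWithin_iff.2
    ⟨hlim, Filter.Eventually.of_forall hmem⟩)).abs
  refine le_of_tendsto this (Filter.Eventually.of_forall fun n => ?_)
  have := h n _ (hle n)
  simpa using this

/-- Bounds a maximum of many increments by a threshold `ρ` plus a sum of powers, whose expectations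
are Gaussian moments. -/
lemma le_add_pow_div {a ρ : ℝ} (ha : 0 ≤ a) (hρ : 0 < ρ) (q : ℕ) :
    a ≤ ρ + a ^ (q + 1) / ρ ^ q := by
  rcases le_total a ρ with h | h
  · have : 0 ≤ a ^ (q + 1) / ρ ^ q := by positivity
    linarith
  · have : a ≤ a ^ (q + 1) / ρ ^ q := by
      rw [le_div_iff₀ (by positivity), pow_succ']
      gcongr
    linarith

namespace IsFractionalBrownianMotion

variable {Ω : Type*} [MeasurableSpace Ω] {P : Measure Ω} [IsProbabilityMeasure P]
  {H : ℝ} {B : ℝ → Ω → ℝ}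

lemma integrable_abs_increment_pow (hB : IsFractionalBrownianMotion H 1 B P) {a b : ℝ}
    (ha : a ∈ Set.Icc 0 1) (hb : b ∈ Set.Icc 0 1) (p : ℕ) :
    Integrable (fun ω => |B b ω - B a ω| ^ p) P := by
  simpa using ((hB.hasGaussianLaw_increment ha hb).memLp (p := p) (by simp)).integrable_norm_pow'

lemma integral_abs_increment_pow (hB : IsFractionalBrownianMotion H 1 B P) (hH : 0 < H) {a b : ℝ}
    (ha : a ∈ Set.Icc 0 1) (hb : b ∈ Set.Icc 0 1) (p : ℕ) :
    ∫ ω, |B b ω - B a ω| ^ p ∂P = (|b - a| ^ H) ^ p * ∫ g, |g| ^ p ∂gaussianReal 0 1 := by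
  have h1 : ∫ ω, |B b ω - B a ω| ^ p ∂P
      = ∫ x, |x| ^ p ∂gaussianReal 0 (|b - a| ^ (2 * H)).toNNReal := by
    rw [← hB.map_increment hH ha hb, integral_map
      (hB.hasGaussianLaw_increment ha hb).aemeasurable (by fun_prop)]
  rw [h1, gaussianReal_zero_eq_map_sqrt_mul, integral_map (by fun_prop) (by fun_prop),
    ← integral_const_mul]
  congr with g
  have : √(((|b - a| ^ (2 * H)).toNNReal : ℝ≥0) : ℝ) = |b - a| ^ H := by
    rw [Real.coe_toNNReal _ (by positivity), Real.sqrt_eq_rpow, ← Real.rpow_mul (abs_nonneg _)]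
    congr 1
    ring
  rw [this, abs_mul, mul_pow, abs_of_nonneg (by positivity)]

/-- The running maximum of `|B|` is integrable. -/
lemma exists_integrable_bound (hB : IsFractionalBrownianMotion H 1 B P) (hH : 0 < H) :
    ∃ D : Ω → ℝ, Integrable D P ∧ ∀ᵐ ω ∂P, ∀ t ∈ Set.Icc (0 : ℝ) 1, |B t ω| ≤ D ω := by
  -- Increments of level `n` have standard deviation `2^{-nH} = r^{2n}`; the threshold `r^n` is much
  -- larger but still summable.
  set r : ℝ := (2 : ℝ) ^ (-(H / 2)) with hr
  have hr0 : 0 < r := by positivity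
  have hr1 : r < 1 := Real.rpow_lt_one_of_one_lt_of_neg one_lt_two (by linarith)
  -- With `2 r^q < 1`, moments of order `q + 1` beat the number `2^n` of increments of level `n`.
  obtain ⟨q, hq⟩ := exists_pow_lt_of_lt_one (by norm_num : (0 : ℝ) < 1 / 2) hr1
  have hmem : ∀ n k : ℕ, k ≤ 2 ^ n → (k / 2 ^ n : ℝ) ∈ Set.Icc (0 : ℝ) 1 := fun n k hk =>
    ⟨by positivity, by rw [div_le_one (by positivity)]; exact_mod_cast hk⟩
  set c : ℝ := ∫ g, |g| ^ (q + 1) ∂gaussianReal 0 1 with hc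
  have hc0 : 0 ≤ c := integral_nonneg fun _ => by positivity
  let e : ℕ → Ω → ℝ := fun n ω => r ^ n + ∑ k ∈ Finset.range (2 ^ n),
    |B ((k + 1 : ℕ) / 2 ^ n) ω - B (k / 2 ^ n) ω| ^ (q + 1) / (r ^ n) ^ q
  have he0 : ∀ n ω, 0 ≤ e n ω := fun n ω => by positivity
  have hinc : ∀ n, ∀ k ∈ Finset.range (2 ^ n), Integrable (fun ω =>
      |B ((k + 1 : ℕ) / 2 ^ n) ω - B (k / 2 ^ n) ω| ^ (q + 1) / (r ^ n) ^ q) P := fun n k hk => by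
    have hk := Finset.mem_range.1 hk
    exact (hB.integrable_abs_increment_pow (hmem n k hk.le) (hmem n _ hk) _).div_const _
  have heint : ∀ n, Integrable (e n) P := fun n =>
    (integrable_const _).add (integrable_finsetSum _ (hinc n))
  have hlen : ∀ n k : ℕ, |((k + 1 : ℕ) / 2 ^ n : ℝ) - k / 2 ^ n| ^ H = (r ^ n) ^ 2 := by
    intro n k
    have h1 : ((k + 1 : ℕ) / 2 ^ n : ℝ) - k / 2 ^ n = (2 : ℝ) ^ (-(n : ℝ)) := by
      rw [Real.rpow_neg (by norm_num), Real.rpow_natCast]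
      push_cast
      field_simp
      ring
    rw [h1, abs_of_pos (by positivity), ← Real.rpow_mul (by positivity), hr, ← Real.rpow_natCast,
      ← Real.rpow_natCast, ← Real.rpow_mul (by positivity), ← Real.rpow_mul (by positivity)]
    congr 1
    push_cast
    ring
  have hele : ∀ n, ∫ ω, e n ω ∂P ≤ (1 + c) * r ^ n := by
    intro n
    have hrn : 0 < r ^ n := by positivity
    calc ∫ ω, e n ω ∂P
        = r ^ n + 2 ^ n * (((r ^ n) ^ 2) ^ (q + 1) * c / (r ^ n) ^ q) := by
          rw [integral_add (integrable_const _) (integrable_finsetSum _ (hinc n)),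
            integral_finsetSum _ (hinc n), Finset.sum_congr rfl (g := fun _ =>
              ((r ^ n) ^ 2) ^ (q + 1) * c / (r ^ n) ^ q)]
          · simp
          · intro k hk
            have hk := Finset.mem_range.1 hk
            rw [integral_div, hB.integral_abs_increment_pow hH (hmem n k hk.le) (hmem n _ hk), hlen]
      _ = r ^ n + c * ((2 * r ^ q) ^ n * (r ^ n) ^ 2) := by
          have : ((r ^ n) ^ 2) ^ (q + 1) * c / (r ^ n) ^ q = c * ((r ^ n) ^ q * (r ^ n) ^ 2) := by
            rw [div_eq_iff (by positivity)]; ring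
          rw [this, mul_pow 2, ← pow_mul r q, mul_comm q, pow_mul]; ring
      _ ≤ r ^ n + c * (1 * (r ^ n * 1)) := by
          gcongr
          · exact pow_le_one₀ (by positivity) (by linarith)
          · rw [sq]
            gcongr
            exact pow_le_one₀ hr0.le hr1.le
      _ = (1 + c) * r ^ n := by ring
  obtain ⟨S, hS, hSle⟩ := exists_integrable_forall_sum_le he0 heint
    (Summable.of_nonneg_of_le (fun n => integral_nonneg (he0 n)) hele
      ((summable_geometric_of_lt_one hr0.le hr1).mul_left _))
  have h00 : (0 : ℝ) ∈ Set.Icc (0 : ℝ) 1 := by simp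
  refine ⟨fun ω => |B 0 ω| + S ω, (hB.hasGaussianLaw_eval h00).integrable.abs.add hS, ?_⟩
  filter_upwards [hSle, hB.continuous_paths] with ω hω hcont t ht
  refine abs_le_of_continuousOn_of_dyadic hcont (fun n k hk => ?_) ht
  refine (abs_dyadic_le_sum (f := fun t => B t ω) (e := fun n => e n ω) (fun n k hk => ?_)
    n k hk).trans (by linarith [hω (n + 1)])
  refine (le_add_pow_div (abs_nonneg _) (by positivity : 0 < r ^ n) q).trans ?_
  have := Finset.single_le_sum (f := fun k : ℕ =>
    |B ((k + 1 : ℕ) / 2 ^ n) ω - B (k / 2 ^ n) ω| ^ (q + 1) / (r ^ n) ^ q)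
    (fun _ _ => by positivity) (Finset.mem_range.2 hk)
  exact add_le_add_right this (r ^ n)

end IsFractionalBrownianMotion

/-! ### Pathwise estimates for the linear equation. -/

section LinearEquation

variable {β σ : ℝ} {b x : ℝ → ℝ}

lemma continuousOn_of_eq_integral (hb : ContinuousOn b (Set.Icc 0 1))
    (hx : IntervalIntegrable x volume 0 1)
    (h : ∀ t ∈ Set.Icc (0 : ℝ) 1, x t = (-β) * (∫ s in (0 : ℝ)..t, x s) + σ * b t) :
    ContinuousOn x (Set.Icc 0 1) := by
  have h1 := intervalIntegral.continuousOn_primitive_interval' hx (Set.left_mem_uIcc)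
  rw [Set.uIcc_of_le zero_le_one] at h1
  exact ((continuousOn_const.mul h1).add (continuousOn_const.mul hb)).congr h

/-- Variation of constants for `x t = -β ∫₀ᵗ x + σ b t`. -/
lemma eq_variation_of_constants (hb : ContinuousOn b (Set.Icc 0 1))
    (hx : IntervalIntegrable x volume 0 1)
    (h : ∀ t ∈ Set.Icc (0 : ℝ) 1, x t = (-β) * (∫ s in (0 : ℝ)..t, x s) + σ * b t)
    {t : ℝ} (ht : t ∈ Set.Icc (0 : ℝ) 1) :
    x t = σ * b t - β * σ * Real.exp (-β * t) * ∫ s in (0 : ℝ)..t, Real.exp (β * s) * b s := by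
  have hxc := continuousOn_of_eq_integral hb hx h
  have hsub : Set.Icc 0 t ⊆ Set.Icc (0 : ℝ) 1 := Set.Icc_subset_Icc_right ht.2
  have hI : ContinuousOn (fun u => ∫ s in (0 : ℝ)..u, x s) (Set.Icc 0 t) := by
    have h1 := intervalIntegral.continuousOn_primitive_interval' hx (Set.left_mem_uIcc)
    rw [Set.uIcc_of_le zero_le_one] at h1
    exact h1.mono hsub
  -- Integrating factor: the equation is first order and linear for the primitive of `x`, so `b`
  -- need not be differentiable.
  have hderiv : ∀ u ∈ Set.Ioo 0 t, HasDerivAt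
      (fun u => Real.exp (β * u) * ∫ s in (0 : ℝ)..u, x s) (σ * (Real.exp (β * u) * b u)) u := by
    intro u hu
    have hu1 : u ∈ Set.Icc (0 : ℝ) 1 := hsub ⟨hu.1.le, hu.2.le⟩
    have hnhds : Set.Icc (0 : ℝ) 1 ∈ nhds u :=
      Icc_mem_nhds hu.1 (hu.2.trans_le ht.2)
    have hd : HasDerivAt (fun u => ∫ s in (0 : ℝ)..u, x s) (x u) u := by
      refine intervalIntegral.integral_hasDerivAt_right (hx.mono_set ?_) ?_
        (hxc.continuousAt hnhds)
      · rw [Set.uIcc_of_le hu1.1, Set.uIcc_of_le zero_le_one]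
        exact Set.Icc_subset_Icc_right hu1.2
      · exact hxc.stronglyMeasurableAtFilter_nhdsWithin measurableSet_Icc u |>.filter_mono
          (by rw [nhdsWithin_eq_nhds.2 hnhds])
    have he : HasDerivAt (fun u => Real.exp (β * u)) (Real.exp (β * u) * β) u := by
      simpa using ((hasDerivAt_id u).const_mul β).exp
    convert! he.mul hd using 1
    rw [h u hu1]
    ring
  have hint : IntervalIntegrable (fun u => σ * (Real.exp (β * u) * b u)) volume 0 t := by
    refine ContinuousOn.intervalIntegrable ?_
    rw [Set.uIcc_of_le ht.1]
    exact continuousOn_const.mul ((by fun_prop : Continuous fun u => Real.exp (β * u)).continuousOn.mul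
      (hb.mono hsub))
  have key := intervalIntegral.integral_eq_sub_of_hasDerivAt_of_le ht.1
    ((by fun_prop : Continuous fun u => Real.exp (β * u)).continuousOn.mul hI) hderiv hint
  simp only [intervalIntegral.integral_const_mul, Pi.mul_apply, intervalIntegral.integral_same,
    mul_zero, sub_zero] at key
  have hexp : Real.exp (-β * t) * Real.exp (β * t) = 1 := by
    rw [← Real.exp_add]; simp
  rw [h t ht]
  linear_combination (β * Real.exp (-β * t)) * key + (β * ∫ s in (0 : ℝ)..t, x s) * hexp

lemma abs_le_of_eq_integral (hβ : |β| < 1) (hb : ContinuousOn b (Set.Icc 0 1))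
    (hx : IntervalIntegrable x volume 0 1)
    (h : ∀ t ∈ Set.Icc (0 : ℝ) 1, x t = (-β) * (∫ s in (0 : ℝ)..t, x s) + σ * b t)
    {M : ℝ} (hM : ∀ t ∈ Set.Icc (0 : ℝ) 1, |b t| ≤ M) {t : ℝ} (ht : t ∈ Set.Icc (0 : ℝ) 1) :
    |x t| ≤ |σ| * (1 + Real.exp 1 * Real.exp 1) * M := by
  have hM0 : 0 ≤ M := (abs_nonneg _).trans (hM 0 (by simp))
  have hexp : ∀ s ∈ Set.Icc (0 : ℝ) 1, ∀ γ : ℝ, |γ| < 1 → Real.exp (γ * s) ≤ Real.exp 1 := by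
    intro s hs γ hγ
    rw [Real.exp_le_exp]
    nlinarith [hs.1, hs.2, (abs_lt.1 hγ).1, (abs_lt.1 hγ).2]
  have hI : |∫ s in (0 : ℝ)..t, Real.exp (β * s) * b s| ≤ Real.exp 1 * M := by
    rw [← Real.norm_eq_abs]
    refine (intervalIntegral.norm_integral_le_of_norm_le_const (C := Real.exp 1 * M)
      (fun s hs => ?_)).trans ?_
    · rw [Set.uIoc_of_le ht.1] at hs
      have hs1 : s ∈ Set.Icc (0 : ℝ) 1 := ⟨hs.1.le, hs.2.trans ht.2⟩
      rw [Real.norm_eq_abs, abs_mul, Real.abs_exp]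
      exact mul_le_mul (hexp s hs1 β hβ) (hM s hs1) (abs_nonneg _) (Real.exp_pos 1).le
    · rw [sub_zero, abs_of_nonneg ht.1]
      exact mul_le_of_le_one_right (by positivity) ht.2
  rw [eq_variation_of_constants hb hx h ht]
  refine (abs_sub _ _).trans ?_
  rw [abs_mul, abs_mul, abs_mul, abs_mul, Real.abs_exp]
  have h1 : |β| * |σ| * Real.exp (-β * t) * |∫ s in (0 : ℝ)..t, Real.exp (β * s) * b s|
      ≤ 1 * |σ| * Real.exp 1 * (Real.exp 1 * M) := by
    have := hexp t ht (-β) (by rwa [abs_neg])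
    gcongr
  have h2 : |σ| * |b t| ≤ |σ| * M := by gcongr; exact hM t ht
  linarith

/-- Solving the equation for `σ b` bounds the noise by the solution; the drift term contributes at
most `|β| W ≤ W`. -/
lemma abs_mul_le_of_eq_integral (hβ : |β| < 1)
    (h : ∀ t ∈ Set.Icc (0 : ℝ) 1, x t = (-β) * (∫ s in (0 : ℝ)..t, x s) + σ * b t)
    {W : ℝ} (hW : ∀ t ∈ Set.Icc (0 : ℝ) 1, |x t| ≤ W) {t : ℝ} (ht : t ∈ Set.Icc (0 : ℝ) 1) :
    |σ| * |b t| ≤ 2 * W := by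
  have hW0 : 0 ≤ W := (abs_nonneg _).trans (hW 0 (by simp))
  have hI : |∫ s in (0 : ℝ)..t, x s| ≤ W := by
    rw [← Real.norm_eq_abs]
    refine (intervalIntegral.norm_integral_le_of_norm_le_const (C := W) (fun s hs => ?_)).trans ?_
    · rw [Set.uIoc_of_le ht.1] at hs
      exact hW s ⟨hs.1.le, hs.2.trans ht.2⟩
    · rw [sub_zero, abs_of_nonneg ht.1]
      exact mul_le_of_le_one_right hW0 ht.2
  have h1 : σ * b t = x t + β * ∫ s in (0 : ℝ)..t, x s := by rw [h t ht]; ring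
  rw [← abs_mul, h1]
  refine (abs_add_le _ _).trans ?_
  rw [abs_mul]
  have : |β| * |∫ s in (0 : ℝ)..t, x s| ≤ 1 * W := by gcongr
  linarith [hW t ht]

end LinearEquation

/-! ### The maximum of the solution as a measurable functional of the noise on the rationals. -/

/-- The rational points of `[0, 1]`. -/
abbrev RatIcc : Type := {q : ℚ // (q : ℝ) ∈ Set.Icc (0 : ℝ) 1}

/-- The point `k / n`, cut off at `1`. -/
def RatIcc.div (n k : ℕ) : RatIcc :=
  ⟨min 1 (k / n), by
    push_cast
    exact ⟨le_min zero_le_one (by positivity), min_le_left _ _⟩⟩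

lemma RatIcc.tendsto_div {t : ℝ} (ht : t ∈ Set.Icc (0 : ℝ) 1) :
    Filter.Tendsto (fun n : ℕ => ((RatIcc.div n ⌊t * n⌋₊ : ℚ) : ℝ)) .atTop
      (nhdsWithin t (Set.Icc 0 1)) := by
  refine tendsto_nhdsWithin_iff.2 ⟨?_, Filter.Eventually.of_forall fun n => (RatIcc.div n _).2⟩
  have h := (tendsto_floor_mul_div_of_tendsto Filter.tendsto_id ht.1)
  have h2 := (tendsto_const_nhds (x := (1 : ℝ))).min h
  rw [min_eq_right ht.2] at h2
  refine h2.congr fun n => ?_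
  simp [RatIcc.div]

lemma iSup_ratIcc_coe_eq {x : ℝ → ℝ} (hx : ContinuousOn x (Set.Icc 0 1)) :
    ⨆ q : RatIcc, ((x (q : ℚ) : ℝ) : EReal) = ((⨆ t : Set.Icc (0 : ℝ) 1, x t : ℝ) : EReal) := by
  have hbdd : BddAbove (Set.range fun t : Set.Icc (0 : ℝ) 1 => x t) := by
    have := isCompact_Icc.bddAbove_image hx
    rwa [Set.image_eq_range] at this
  refine le_antisymm (iSup_le fun q => EReal.coe_le_coe_iff.2 (le_ciSup hbdd ⟨_, q.2⟩)) ?_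
  obtain ⟨t, ht, hmax⟩ := isCompact_Icc.exists_isMaxOn (Set.nonempty_Icc.2 zero_le_one) hx
  have hle : ⨆ t : Set.Icc (0 : ℝ) 1, x t ≤ x t := ciSup_le fun s => hmax s.2
  refine (EReal.coe_le_coe_iff.2 hle).trans ?_
  have hlim := (continuous_coe_real_ereal.tendsto (x t)).comp
    ((hx t ht).tendsto.comp (RatIcc.tendsto_div ht))
  exact le_of_tendsto hlim (Filter.Eventually.of_forall fun n =>
    le_iSup (fun q : RatIcc => ((x (q : ℚ) : ℝ) : EReal)) _)

/-- The `n`-th step-function approximation of the solution at time `q` of the linear equation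
driven by `σ b`. -/
noncomputable def solutionApprox (β σ : ℝ) (n : ℕ) (q : RatIcc) (b : RatIcc → ℝ) : ℝ :=
  σ * b q - β * σ * Real.exp (-β * (q : ℚ)) *
    ∫ s in (0 : ℝ)..(q : ℚ), Real.exp (β * s) * b (RatIcc.div n ⌊s * n⌋₊)

/-- The maximum over `[0, 1]` of the solution of the linear equation driven by `σ b`, as a
functional of the restriction of `b` to the rationals. -/
noncomputable def solutionSup (β σ : ℝ) (b : RatIcc → ℝ) : ℝ :=
  (⨆ q, Filter.limsup (fun n => (solutionApprox β σ n q b : EReal)) .atTop).toReal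

lemma measurable_solutionApprox (β σ : ℝ) (n : ℕ) (q : RatIcc) :
    Measurable (solutionApprox β σ n q) := by
  -- The step function sees `s` only through the natural number `⌊s * n⌋₊`, so joint measurability
  -- reduces to a countable factor and coordinate maps.
  have h1 : Measurable fun p : (RatIcc → ℝ) × ℕ => p.1 (RatIcc.div n p.2) :=
    measurable_from_prod_countable_left fun k =>
      measurable_pi_apply (RatIcc.div n k)
  have h2 : Measurable fun p : (RatIcc → ℝ) × ℝ =>
      Real.exp (β * p.2) * p.1 (RatIcc.div n ⌊p.2 * n⌋₊) :=
    (by fun_prop : Measurable fun p : (RatIcc → ℝ) × ℝ => Real.exp (β * p.2)).mul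
      (h1.comp (measurable_fst.prodMk (Nat.measurable_floor.comp (measurable_snd.mul_const _))))
  have h3 : Measurable fun b : RatIcc → ℝ =>
      ∫ s in (0 : ℝ)..(q : ℚ), Real.exp (β * s) * b (RatIcc.div n ⌊s * n⌋₊) := by
    simp only [intervalIntegral.integral_of_le q.2.1]
    exact (h2.stronglyMeasurable.integral_prod_right
      (ν := volume.restrict (Set.Ioc (0 : ℝ) (q : ℚ)))).measurable
  exact ((measurable_pi_apply q).const_mul σ).sub (h3.const_mul _)

/-- Taking `limsup` and `⨆` in `EReal` gives measurability on the whole product space; only for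
continuous noise is the `limsup` identified with a limit. -/
lemma measurable_solutionSup (β σ : ℝ) : Measurable (solutionSup β σ) :=
  (Measurable.iSup fun q => Measurable.limsup fun n =>
    (measurable_solutionApprox β σ n q).coe_real_ereal).ereal_toReal

lemma tendsto_solutionApprox {β σ : ℝ} {b x : ℝ → ℝ} (hb : ContinuousOn b (Set.Icc 0 1))
    (hx : IntervalIntegrable x volume 0 1)
    (h : ∀ t ∈ Set.Icc (0 : ℝ) 1, x t = (-β) * (∫ s in (0 : ℝ)..t, x s) + σ * b t) (q : RatIcc) :
    Filter.Tendsto (fun n => solutionApprox β σ n q fun q => b (q : ℚ)) .atTop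
      (nhds (x (q : ℚ))) := by
  rw [eq_variation_of_constants hb hx h q.2]
  obtain ⟨M, hM⟩ := isCompact_Icc.exists_bound_of_continuousOn hb
  refine tendsto_const_nhds.sub (Filter.Tendsto.const_mul _ ?_)
  refine intervalIntegral.tendsto_integral_filter_of_dominated_convergence
    (fun s => Real.exp (β * s) * M) (Filter.Eventually.of_forall fun n => ?_)
    (Filter.Eventually.of_forall fun n => Filter.Eventually.of_forall fun s _ => ?_)
    (by apply Continuous.intervalIntegrable; fun_prop)
    (Filter.Eventually.of_forall fun s hs => ?_)
  · have h1 : Measurable fun s : ℝ => b (RatIcc.div n ⌊s * n⌋₊ : ℚ) :=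
      (measurable_from_nat (f := fun k => b (RatIcc.div n k : ℚ))).comp
        (Nat.measurable_floor.comp (measurable_id.mul_const _))
    exact ((by fun_prop : Measurable fun s : ℝ => Real.exp (β * s)).mul h1).aestronglyMeasurable
  · rw [norm_mul, Real.norm_eq_abs, Real.abs_exp]
    gcongr
    exact hM _ (RatIcc.div n _).2
  · rw [Set.uIoc_of_le q.2.1] at hs
    have hs1 : s ∈ Set.Icc (0 : ℝ) 1 := ⟨hs.1.le, hs.2.trans q.2.2⟩
    exact ((hb s hs1).tendsto.comp (RatIcc.tendsto_div hs1)).const_mul _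

lemma solutionSup_eq_iSup {β σ : ℝ} {b x : ℝ → ℝ} (hb : ContinuousOn b (Set.Icc 0 1))
    (hx : IntervalIntegrable x volume 0 1)
    (h : ∀ t ∈ Set.Icc (0 : ℝ) 1, x t = (-β) * (∫ s in (0 : ℝ)..t, x s) + σ * b t) :
    solutionSup β σ (fun q => b (q : ℚ)) = ⨆ t : Set.Icc (0 : ℝ) 1, x t := by
  have hlim : ∀ q : RatIcc, Filter.limsup
      (fun n => (solutionApprox β σ n q (fun q => b (q : ℚ)) : EReal)) .atTop
      = ((x (q : ℚ) : ℝ) : EReal) := fun q =>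
    ((continuous_coe_real_ereal.tendsto _).comp (tendsto_solutionApprox hb hx h q)).limsup_eq
  rw [solutionSup]
  simp_rw [hlim]
  rw [iSup_ratIcc_coe_eq (continuousOn_of_eq_integral hb hx h), EReal.toReal_coe]

/-! ### Symmetry of the law of `B`. -/

/-- The characteristic function of a centered Gaussian depends only on the variances of the
functionals `L ∘ Z`, which a sign change preserves. -/
lemma ProbabilityTheory.HasGaussianLaw.identDistrib_neg {Ω E : Type*} [MeasurableSpace Ω] {P : Measure Ω}
    [NormedAddCommGroup E] [NormedSpace ℝ E] [MeasurableSpace E] [BorelSpace E] [CompleteSpace E]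
    [SecondCountableTopology E] {Z : Ω → E} (hZ : HasGaussianLaw Z P) (h0 : P[Z] = 0) :
    IdentDistrib Z (-Z) P P where
  aemeasurable_fst := hZ.aemeasurable
  aemeasurable_snd := hZ.neg.aemeasurable
  map_eq := by
    have := hZ.isProbabilityMeasure
    have := hZ.isGaussian_map
    have := hZ.neg.isGaussian_map
    have hL : ∀ L : StrongDual ℝ E, P[L ∘ Z] = 0 := fun L => by
      have := L.integral_comp_comm hZ.integrable
      rw [h0, map_zero] at this
      exact this
    refine Measure.ext_of_charFunDual (funext fun L => ?_)
    have hneg : L ∘ (-Z) = -(L ∘ Z) := by ext; simp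
    rw [hZ.charFunDual_map_eq, hZ.neg.charFunDual_map_eq, hneg, variance_neg, hL]
    simp only [Pi.neg_apply, integral_neg]
    rw [hL, neg_zero]

namespace IsFractionalBrownianMotion

variable {Ω : Type*} [MeasurableSpace Ω] {P : Measure Ω} {H : ℝ} {B : ℝ → Ω → ℝ}

lemma neg {T : ℝ} (hB : IsFractionalBrownianMotion H T B P) :
    IsFractionalBrownianMotion H T (fun t ω => -B t ω) P where
  isGaussianProcess := by simpa using hB.isGaussianProcess.smul fun _ => -1
  centered t ht := by rw [integral_neg, hB.centered t ht, neg_zero]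
  covariance t ht s hs := by simpa using hB.covariance t ht s hs
  continuous_paths := by filter_upwards [hB.continuous_paths] with ω h using h.neg

variable [IsProbabilityMeasure P]

lemma identDistrib_neg_rat (hB : IsFractionalBrownianMotion H 1 B P) :
    IdentDistrib (fun ω (q : RatIcc) => B (q : ℚ) ω) (fun ω q => -B (q : ℚ) ω) P P := by
  have hG : IsGaussianProcess (fun (q : RatIcc) => B (q : ℚ)) P :=
    hB.isGaussianProcess.comp_right fun q : RatIcc => (⟨_, q.2⟩ : Set.Icc (0 : ℝ) 1)
  refine (identDistrib_iff_forall_finset_identDistrib (Y := fun (q : RatIcc) ω => -B (q : ℚ) ω)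
    (aemeasurable_pi_lambda _ fun q => hG.aemeasurable q)
    (aemeasurable_pi_lambda _ fun q => (hG.aemeasurable q).neg)).2 ?_
  intro I
  refine HasGaussianLaw.identDistrib_neg (hG.hasGaussianLaw I) (funext fun i => ?_)
  exact (eval_integral (f := fun ω (i : I) => B (i.1 : ℚ) ω)
    (fun j => (hG.hasGaussianLaw_eval j.1).integrable) i).trans (hB.centered _ i.1.2)

end IsFractionalBrownianMotion

/-! ### The running maximum of the Ornstein–Uhlenbeck process. -/

namespace IsFractionalOUProcess

variable {Ω : Type*} [MeasurableSpace Ω] {P : Measure Ω} {H β σ : ℝ} {B X : ℝ → Ω → ℝ}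

lemma ae_solution (hX : IsFractionalOUProcess β σ 1 B X P)
    (hB : IsFractionalBrownianMotion H 1 B P) (hH : 0 < H) :
    ∀ᵐ ω ∂P, ContinuousOn (fun t => B t ω) (Set.Icc 0 1) ∧
      IntervalIntegrable (fun s => X s ω) volume 0 1 ∧ X 0 ω = 0 ∧
      ∀ t ∈ Set.Icc (0 : ℝ) 1, X t ω = (-β) * (∫ s in (0 : ℝ)..t, X s ω) + σ * B t ω := by
  filter_upwards [hB.continuous_paths, hX.integrable_paths, hX.initial, hX.equation,
    hB.ae_eval_zero_eq_zero hH zero_le_one] with ω h1 h2 h3 h4 h5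
  refine ⟨h1, h2, h3, fun t ht => ?_⟩
  rw [h4 t ht, h3, h5, zero_add, sub_zero]

lemma neg (hX : IsFractionalOUProcess β σ 1 B X P) :
    IsFractionalOUProcess β σ 1 (fun t ω => -B t ω) (fun t ω => -X t ω) P where
  initial := by filter_upwards [hX.initial] with ω h; simp [h]
  integrable_paths := by filter_upwards [hX.integrable_paths] with ω h using h.neg
  equation := by
    filter_upwards [hX.equation] with ω h t ht
    rw [h t ht, intervalIntegral.integral_neg]
    ring

lemma iSup_ae_eq (hX : IsFractionalOUProcess β σ 1 B X P)
    (hB : IsFractionalBrownianMotion H 1 B P) (hH : 0 < H) :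
    (fun ω => solutionSup β σ fun q => B (q : ℚ) ω)
      =ᵐ[P] fun ω => ⨆ t : Set.Icc (0 : ℝ) 1, X t ω := by
  filter_upwards [hX.ae_solution hB hH] with ω ⟨h1, h2, _, h4⟩
  exact solutionSup_eq_iSup (b := fun t => B t ω) (x := fun t => X t ω) h1 h2 h4

lemma ae_iSup_bounds (hX : IsFractionalOUProcess β σ 1 B X P)
    (hB : IsFractionalBrownianMotion H 1 B P) (hH : 0 < H) :
    ∀ᵐ ω ∂P, 0 ≤ (⨆ t : Set.Icc (0 : ℝ) 1, X t ω) ∧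
      ∀ t ∈ Set.Icc (0 : ℝ) 1, X t ω ≤ ⨆ t : Set.Icc (0 : ℝ) 1, X t ω := by
  filter_upwards [hX.ae_solution hB hH] with ω ⟨h1, h2, h3, h4⟩
  have hc : ContinuousOn (fun t => X t ω) (Set.Icc 0 1) :=
    continuousOn_of_eq_integral (b := fun t => B t ω) h1 h2 h4
  -- A real `⨆` over an unbounded family is `0` by convention, so continuity of the path is needed
  -- for it to be a true supremum.
  have hbdd : BddAbove (Set.range fun t : Set.Icc (0 : ℝ) 1 => X t ω) := by
    have := isCompact_Icc.bddAbove_image hc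
    rwa [Set.image_eq_range] at this
  have hle : ∀ t ∈ Set.Icc (0 : ℝ) 1, X t ω ≤ ⨆ t : Set.Icc (0 : ℝ) 1, X t ω := fun t ht =>
    le_ciSup hbdd ⟨t, ht⟩
  exact ⟨h3.symm.le.trans (hle 0 (by simp)), hle⟩

variable [IsProbabilityMeasure P]

lemma integrable_iSup (hX : IsFractionalOUProcess β σ 1 B X P)
    (hB : IsFractionalBrownianMotion H 1 B P) (hH : 0 < H) (hβ : |β| < 1) :
    Integrable (fun ω => ⨆ t : Set.Icc (0 : ℝ) 1, X t ω) P := by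
  obtain ⟨D, hD, hBD⟩ := hB.exists_integrable_bound hH
  refine (hD.const_mul (|σ| * (1 + Real.exp 1 * Real.exp 1))).mono' ?_ ?_
  · refine AEMeasurable.aestronglyMeasurable (AEMeasurable.congr ?_ (hX.iSup_ae_eq hB hH))
    exact (measurable_solutionSup β σ).comp_aemeasurable hB.identDistrib_neg_rat.aemeasurable_fst
  · filter_upwards [hX.ae_solution hB hH, hX.ae_iSup_bounds hB hH, hBD] with ω ⟨h1, h2, _, h4⟩ h5 h6
    rw [Real.norm_eq_abs, abs_of_nonneg h5.1]
    exact ciSup_le fun t => (le_abs_self _).trans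
      (abs_le_of_eq_integral (b := fun t => B t ω) (x := fun t => X t ω) hβ h1 h2 h4 h6 t.2)

/-- `-X` solves the equation driven by `-B`, so both suprema are the same functional `solutionSup`
of identically distributed noises. -/
lemma integral_iSup_neg (hX : IsFractionalOUProcess β σ 1 B X P)
    (hB : IsFractionalBrownianMotion H 1 B P) (hH : 0 < H) :
    ∫ ω, (⨆ t : Set.Icc (0 : ℝ) 1, -X t ω) ∂P = ∫ ω, (⨆ t : Set.Icc (0 : ℝ) 1, X t ω) ∂P := by
  rw [← integral_congr_ae (hX.iSup_ae_eq hB hH), ← integral_congr_ae (hX.neg.iSup_ae_eq hB.neg hH)]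
  exact (hB.identDistrib_neg_rat.comp (measurable_solutionSup β σ)).integral_eq.symm

lemma abs_mul_inv_sqrt_le_integral_iSup (hX : IsFractionalOUProcess β σ 1 B X P)
    (hB : IsFractionalBrownianMotion H 1 B P) (hH : 0 < H) (hβ : |β| < 1) :
    Real.exp (-2) / 64 * (|σ| / √H) ≤ ∫ ω, (⨆ t : Set.Icc (0 : ℝ) 1, X t ω) ∂P := by
  rcases eq_or_ne σ 0 with rfl | hσ
  · rw [abs_zero, zero_div, mul_zero]
    refine integral_nonneg_of_ae ?_
    filter_upwards [hX.ae_iSup_bounds hB hH] with ω h using h.1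
  have hσ0 : 0 < |σ| := abs_pos.2 hσ
  -- Both summands are nonnegative because `X` starts at `0`, so their sum dominates `|X|`; by
  -- symmetry its mean is twice that of `sup X`.
  set W : Ω → ℝ := fun ω => (⨆ t : Set.Icc (0 : ℝ) 1, X t ω) + ⨆ t : Set.Icc (0 : ℝ) 1, -X t ω
    with hW
  have hi1 := hX.integrable_iSup hB hH hβ
  have hi2 := hX.neg.integrable_iSup hB.neg hH hβ
  have hWint : Integrable W P := hi1.add hi2
  have hEW : ∫ ω, W ω ∂P = 2 * ∫ ω, (⨆ t : Set.Icc (0 : ℝ) 1, X t ω) ∂P := by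
    rw [hW, integral_add hi1 hi2, hX.integral_iSup_neg hB hH]
    ring
  have hBW : ∀ᵐ ω ∂P, ∀ t ∈ Set.Icc (0 : ℝ) 1, |B t ω| ≤ 2 / |σ| * W ω := by
    filter_upwards [hX.ae_solution hB hH, hX.ae_iSup_bounds hB hH,
      hX.neg.ae_iSup_bounds hB.neg hH] with ω ⟨_, _, _, h4⟩ h5 h6 t ht
    have hXW : ∀ t ∈ Set.Icc (0 : ℝ) 1, |X t ω| ≤ W ω := fun t ht =>
      abs_le.2 ⟨by linarith [h5.1, h6.2 t ht], by linarith [h6.1, h5.2 t ht]⟩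
    have := abs_mul_le_of_eq_integral (b := fun t => B t ω) hβ h4 hXW ht
    rw [div_mul_eq_mul_div, le_div_iff₀ hσ0]
    linarith
  have key := hB.inv_sqrt_le_integral hH (hWint.const_mul _) hBW
  rw [integral_const_mul, hEW, div_mul_eq_mul_div 2, le_div_iff₀ hσ0] at key
  have : Real.exp (-2) / 64 * (|σ| / √H) = (Real.exp (-2) / 16 * (1 / √H) * |σ|) / 4 := by ring
  linarith

end IsFractionalOUProcess

/-! ### Comparison with the logarithmic bound. -/

/-- Uses `log |y| ≤ |y| - 1 ≤ y²`. The conventions `Real.log y = Real.log |y|` and `√` of a negative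
number `= 0` match the intended reading for negative or small `σ`. -/
lemma sqrt_log_le_abs (y : ℝ) : √(Real.log y) ≤ |y| := by
  rcases eq_or_ne y 0 with rfl | hy
  · simp
  rw [Real.sqrt_le_left (abs_nonneg y), ← Real.log_abs]
  have := Real.log_le_sub_one_of_pos (abs_pos.2 hy)
  nlinarith [sq_nonneg (|y| - 1)]

lemma exp_mul_sqrt_log_le (σ : ℝ) {H b : ℝ} (hH : 0 < H) (hb : 0 ≤ b) :
    Real.exp (-(1 / 2)) * √((1 / H) * Real.log (σ * Real.exp (-2 * b) / Real.exp (-(1 / 2))))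
      ≤ |σ| / √H := by
  have h1 := sqrt_log_le_abs (σ * Real.exp (-2 * b) / Real.exp (-(1 / 2)))
  rw [abs_div, abs_mul, Real.abs_exp, Real.abs_exp, le_div_iff₀ (Real.exp_pos _)] at h1
  have h2 : |σ| * Real.exp (-2 * b) ≤ |σ| :=
    mul_le_of_le_one_right (abs_nonneg σ) (Real.exp_le_one_iff.2 (by linarith))
  rw [Real.sqrt_mul (by positivity), one_div H, Real.sqrt_inv, ← div_eq_inv_mul, ← mul_div_assoc]
  gcongr
  linarith

theorem theorem2 :
    ∃ c : ℝ, 0 < c ∧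
      ∀ (H β σ : ℝ), 0 < H → H < 1 → |β| < 1 →
      ∀ (Ω : Type*) [MeasurableSpace Ω] (P : Measure Ω) [IsProbabilityMeasure P]
        (B X : ℝ → Ω → ℝ),
        IsFractionalBrownianMotion H 1 B P →
        IsFractionalOUProcess β σ 1 B X P →
        Integrable (fun ω => ⨆ t : Set.Icc (0 : ℝ) 1, X t ω) P ∧
        c * (Real.exp (-(1 / 2)) *
            √((1 / H) * Real.log (σ * Real.exp (-2 * |β|) / Real.exp (-(1 / 2)))))
          ≤ ∫ ω, (⨆ t : Set.Icc (0 : ℝ) 1, X t ω) ∂P := by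
  -- `e⁻²/16` comes from the bound on `|B|`; the other `1/4` from the factor `2` in `|σ| |B| ≤ 2 W`
  -- and the `2` in `E W = 2 E[sup X]`.
  refine ⟨Real.exp (-2) / 64, by positivity, ?_⟩
  intro H β σ hH _ hβ Ω _ P _ B X hB hX
  refine ⟨hX.integrable_iSup hB hH hβ, le_trans ?_
    (hX.abs_mul_inv_sqrt_le_integral_iSup hB hH hβ)⟩
  gcongr
  exact exp_mul_sqrt_log_le σ hH (abs_nonneg β)
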